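/- Let $L/K$ be a finite Galois extension of number fields. Write $\mathbb{P}_K$ for the set of nonzero prime ideals of $\mathcal{O}_K$ and $\mathbb{Q}^{\mathrm{ab}}\subset\mathbb{C}$ for the maximal abelian extension of $\mathbb{Q}$. For each $\mathfrak{q}\in\mathbb{P}_K$ let $x_1^{(\mathfrak{q})},x_2^{(\mathfrak{q})},\dots$ be commuting variables, and let $\mathcal{A}_K$ be the ring of formal power series over $\mathbb{Q}^{\mathrm{ab}}$ in all the variables $x_i^{(\mathfrak{q})}$ ($\mathfrak q\in\mathbb P_K$, $i\ge 1$) that are symmetric in each alphabet $(x_i^{(\mathfrak{q})})_{i\ge 1}$ separately (the completion of $\bigotimes_{\mathfrak{q}}\Lambda[\mathfrak{X}^{(\mathfrak{q})}]$, where $\Lambda$ is the ring of symmetric functions over $\mathbb{Q}^{\mathrm{ab}}$). Define, in $\mathcal{A}_K$, $$\zeta_K[\mathfrak{X}_K]=\prod_{\mathfrak{q}\in\mathbb{P}_K}\prod_{i\ge1}\bigl(1-x_i^{(\mathfrak{q})}\bigr)^{-1},\qquad \zeta_{L/K}[\mathfrak{X}_K]=\prod_{\mathfrak{q}\in\mathbb{P}_K}\prod_{\mathfrak{p}\mid\mathfrak{q}}\prod_{i\ge1}\bigl(1-(x_i^{(\mathfrak{q})})^{f(\mathfrak{p}|\mathfrak{q})}\bigr)^{-1},$$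 where $\mathfrak{p}$ runs over the primes of $L$ above $\mathfrak{q}$ and $f(\mathfrak{p}|\mathfrak{q})$ is the residue degree. For each $\mathfrak{q}\in\mathbb{P}_K$ choose a prime of $L$ above $\mathfrak{q}$; let $I(\mathfrak{q})\subset D(\mathfrak{q})\subset\mathrm{Gal}(L/K)$ be its inertia and decomposition groups and $\sigma_{\mathfrak{q}}\in D(\mathfrak{q})/I(\mathfrak{q})$ its Frobenius element. For a finite-dimensional complex representation $\rho\colon\mathrm{Gal}(L/K)\to\mathrm{GL}(V)$ define the Artin symmetric function $$\mathcal{L}(\mathfrak{X}_K,\rho;L/K)=\prod_{\mathfrak{q}\in\mathbb{P}_K}\prod_{i\ge1}\det\bigl(\mathrm{Id}-x_i^{(\mathfrak{q})}\rho(\sigma_{\mathfrak{q}})\,\big|\,V^{I(\mathfrak{q})}\bigr)^{-1}\in\mathcal{A}_K.$$ Then, for every choice of primes above the $\mathfrak{q}$, $$\zeta_{L/K}[\mathfrak{X}_K]=\zeta_K[\mathfrak{X}_K]\prod_{\rho\neq\mathbb{1}}\mathcal{L}(\mathfrak{X}_K,\rho;L/K)^{\dim\rho},$$ where $\rho$ runs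 over the (finitely many) equivalence classes of nontrivial irreducible complex representations of $\mathrm{Gal}(L/K)$. -/

import Mathlib

open NumberField
open scoped MvPowerSeries.WithPiTopology

namespace ArithSymm

noncomputable section

/-! ### Formal infinite products of power series -/

/-- The product of a family of formal power series, i.e. the limit of the finite subproducts for
coefficientwise convergence, where the coefficient field is discrete. -/
def formalProd {σ ι k : Type*} [Field k] (f : ι → MvPowerSeries σ k) : MvPowerSeries σ k :=
  letI : TopologicalSpace k := ⊥
  ∏' i, f i

/-- The formal product of the family `f` converges. -/
def FormallyMultipliable {σ ι k : Type*} [Field k] (f : ι → MvPowerSeries σ k) : Prop :=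
  letI : TopologicalSpace k := ⊥
  Multipliable f

/-- A family of power series with constant coefficient `1` such that every monomial is affected by
only finitely many members has a convergent formal product. -/
theorem FormallyMultipliable.of_finite {σ ι k : Type*} [Field k] {f : ι → MvPowerSeries σ k}
    (h1 : ∀ i, MvPowerSeries.constantCoeff (f i) = 1)
    (hfin : ∀ d : σ →₀ ℕ, {i | ∃ e ≤ d, e ≠ 0 ∧ MvPowerSeries.coeff e (f i) ≠ 0}.Finite) :
    FormallyMultipliable f := by
  classical
  let : TopologicalSpace k := ⊥
  have : DiscreteTopology k := ⟨rfl⟩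
  have key : ∀ d : σ →₀ ℕ, ∀ S : Finset ι, (hfin d).toFinset ⊆ S →
      MvPowerSeries.coeff d (∏ i ∈ S, f i) =
        MvPowerSeries.coeff d (∏ i ∈ (hfin d).toFinset, f i) := by
    intro d S hS
    have h2 : ∀ T : Finset ι, (∀ i ∈ T, i ∉ (hfin d).toFinset) → ∀ e ≤ d,
        MvPowerSeries.coeff e (∏ i ∈ T, f i) = if e = 0 then 1 else 0 := by
      intro T
      induction T using Finset.induction_on with
      | empty => intro _ e _; simp [MvPowerSeries.coeff_one]
      | insert a T ha ih =>
        intro hT e he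
        rw [Finset.prod_insert ha, MvPowerSeries.coeff_mul]
        have hz : ∀ e' ≤ d, e' ≠ 0 → MvPowerSeries.coeff e' (f a) = 0 := by
          intro e' he' h0
          by_contra hne
          exact hT a (Finset.mem_insert_self _ _) (by simpa using ⟨e', he', h0, hne⟩)
        rw [Finset.sum_eq_single (0, e)]
        · rw [MvPowerSeries.coeff_zero_eq_constantCoeff_apply, h1, one_mul]
          exact ih (fun i hi => hT i (Finset.mem_insert_of_mem hi)) e he
        · rintro ⟨x, y⟩ hxy hne
          have hsum : x + y = e := Finset.HasAntidiagonal.mem_antidiagonal.mp hxy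
          have hx0 : x ≠ 0 := by
            rintro rfl
            exact hne (by simpa using hsum)
          rw [hz x (le_trans (by rw [← hsum]; exact le_self_add) he) hx0, zero_mul]
        · intro h; exact absurd (Finset.HasAntidiagonal.mem_antidiagonal.mpr (zero_add e)) h
    rw [← Finset.sdiff_union_of_subset hS, Finset.prod_union Finset.sdiff_disjoint,
      MvPowerSeries.coeff_mul, Finset.sum_eq_single (0, d)]
    · rw [h2 _ (fun i hi => (Finset.mem_sdiff.mp hi).2) 0 (by simp)]; simp
    · rintro ⟨x, y⟩ hxy hne
      have hsum : x + y = d := Finset.HasAntidiagonal.mem_antidiagonal.mp hxy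
      have hx0 : x ≠ 0 := by
        rintro rfl
        exact hne (by simpa using hsum)
      rw [h2 _ (fun i hi => (Finset.mem_sdiff.mp hi).2) x (by rw [← hsum]; exact le_self_add),
        if_neg hx0, zero_mul]
    · intro h; exact absurd (Finset.HasAntidiagonal.mem_antidiagonal.mpr (zero_add d)) h
  refine ⟨fun d => MvPowerSeries.coeff d (∏ i ∈ (hfin d).toFinset, f i), ?_⟩
  refine (MvPowerSeries.WithPiTopology.tendsto_iff_coeff_tendsto _ _ _).mpr fun d => ?_
  rw [SummationFilter.unconditional_filter]
  exact tendsto_atTop_of_eventually_const (i₀ := (hfin d).toFinset) fun S hS => key d S hS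

/-- The power series with constant coefficient `1` in which only variables from `s` occur. -/
def unipotentOn {σ : Type*} (k : Type*) [Field k] (s : Set σ) : Submonoid (MvPowerSeries σ k) where
  carrier := {F | MvPowerSeries.constantCoeff F = 1 ∧
    ∀ e, MvPowerSeries.coeff e F ≠ 0 → (e.support : Set σ) ⊆ s}
  one_mem' := by
    classical
    refine ⟨map_one _, fun e he => ?_⟩
    rw [MvPowerSeries.coeff_one] at he
    have : e = 0 := by by_contra h; simp [h] at he
    simp [this]
  mul_mem' := by
    classical
    rintro F G ⟨hF, hF'⟩ ⟨hG, hG'⟩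
    refine ⟨by rw [map_mul, hF, hG, one_mul], fun e he => ?_⟩
    rw [MvPowerSeries.coeff_mul] at he
    obtain ⟨⟨x, y⟩, hxy, hne⟩ := Finset.exists_ne_zero_of_sum_ne_zero he
    have hsum : x + y = e := Finset.HasAntidiagonal.mem_antidiagonal.mp hxy
    have hx := hF' x (left_ne_zero_of_mul hne)
    have hy := hG' y (right_ne_zero_of_mul hne)
    intro i hi
    have : i ∈ x.support ∪ y.support := Finsupp.support_add (by rw [hsum]; exact hi)
    rcases Finset.mem_union.mp this with h | h
    · exact hx h
    · exact hy h

theorem inv_mem_unipotentOn {σ k : Type*} [Field k] {s : Set σ} {F : MvPowerSeries σ k}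
    (hF : F ∈ unipotentOn k s) : F⁻¹ ∈ unipotentOn k s := by
  classical
  refine ⟨by rw [MvPowerSeries.constantCoeff_inv, hF.1, inv_one], fun e => ?_⟩
  induction e using WellFoundedLT.induction with
  | ind e ih =>
    intro he
    rw [MvPowerSeries.coeff_inv] at he
    split_ifs at he with h0
    · simp [h0]
    · obtain ⟨⟨x, y⟩, hxy, hne⟩ := Finset.exists_ne_zero_of_sum_ne_zero (right_ne_zero_of_mul he)
      have hsum : x + y = e := Finset.HasAntidiagonal.mem_antidiagonal.mp hxy
      dsimp only at hne
      split_ifs at hne with hlt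
      · have hx := hF.2 x (left_ne_zero_of_mul hne)
        have hy := ih y hlt (right_ne_zero_of_mul hne)
        intro i hi
        have : i ∈ x.support ∪ y.support := Finsupp.support_add (by rw [hsum]; exact hi)
        rcases Finset.mem_union.mp this with h | h
        · exact hx h
        · exact hy h
      · exact absurd rfl hne

theorem formalProd_mem_unipotentOn {σ ι k : Type*} [Field k] {s : Set σ}
    {f : ι → MvPowerSeries σ k} (hf : ∀ i, f i ∈ unipotentOn k s) (hm : FormallyMultipliable f) :
    formalProd f ∈ unipotentOn k s := by
  let : TopologicalSpace k := ⊥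
  have : DiscreteTopology k := ⟨rfl⟩
  have hp : HasProd f (formalProd f) := Multipliable.hasProd hm
  have hc := (MvPowerSeries.WithPiTopology.tendsto_iff_coeff_tendsto _ _ _).mp hp
  have hev : ∀ d, ∃ S : Finset ι, MvPowerSeries.coeff d (∏ i ∈ S, f i) =
      MvPowerSeries.coeff d (formalProd f) := by
    intro d
    have := hc d
    rw [SummationFilter.unconditional_filter, nhds_discrete, Filter.tendsto_pure] at this
    exact this.exists
  have hS : ∀ S : Finset ι, ∏ i ∈ S, f i ∈ unipotentOn k s :=
    fun S => Submonoid.prod_mem _ fun i _ => hf i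
  constructor
  · obtain ⟨S, h⟩ := hev 0
    simpa using h.symm.trans (hS S).1
  · intro e he
    obtain ⟨S, h⟩ := hev e
    exact (hS S).2 e (by rwa [h])

theorem FormallyMultipliable.of_mem_unipotentOn {σ ι k : Type*} [Field k]
    {f : ι → MvPowerSeries σ k} {s : ι → Set σ} (hs : Pairwise (Function.onFun Disjoint s))
    (hf : ∀ i, f i ∈ unipotentOn k (s i)) : FormallyMultipliable f := by
  classical
  refine .of_finite (fun i => (hf i).1) fun d => ?_
  refine Set.Finite.subset (s := ⋃ v ∈ d.support, {i | v ∈ s i}) ?_ ?_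
  · refine Set.Finite.biUnion (Finset.finite_toSet _) fun v _ => Set.Subsingleton.finite ?_
    intro i hi j hj
    by_contra hne
    exact Set.disjoint_left.mp (hs hne) hi hj
  · rintro i ⟨e, hed, he0, hne⟩
    obtain ⟨v, hv⟩ := Finsupp.support_nonempty_iff.mpr he0
    exact Set.mem_biUnion (x := v) (Finsupp.support_mono hed hv) ((hf i).2 e hne hv)

/-! ### Symmetric power series in several alphabets -/

/-- The power series in the variables `x_i^(q)` (`q : P`, `i : ℕ`) that are invariant under all
permutations of each alphabet `x^(q)`, separately for each `q`. No bound on the degrees and on the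
number of alphabets is imposed, so this is the completion of `⨂_q Λ[x^(q)]`: the part of a given
multidegree `(d_q)_q` involves only the finitely many alphabets with `d_q ≠ 0` and is a finite
linear combination of products of monomial symmetric functions in these. -/
def symmSeries (P k : Type*) [Field k] : Subalgebra k (MvPowerSeries (P × ℕ) k) where
  carrier := {F | ∀ π : P → Equiv.Perm ℕ,
    MvPowerSeries.renameEquiv k (Equiv.prodCongrRight π) F = F}
  mul_mem' hF hG π := by rw [map_mul, hF, hG]
  add_mem' hF hG π := by rw [map_add, hF, hG]
  algebraMap_mem' r π := AlgEquiv.commutes _ r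

theorem continuous_renameEquiv {σ k : Type*} [Field k] [TopologicalSpace k] (e : σ ≃ σ) :
    Continuous (MvPowerSeries.renameEquiv k e) := by
  refine continuous_pi fun d => ?_
  have h : ∀ F : MvPowerSeries σ k, MvPowerSeries.renameEquiv k e F d =
      MvPowerSeries.coeff (Finsupp.embDomain e.symm.toEmbedding d) F := by
    intro F
    have h1 := MvPowerSeries.coeff_embDomain_rename (e.symm.toEmbedding)
      (MvPowerSeries.renameEquiv k e F) d
    rw [show MvPowerSeries.rename (e.symm.toEmbedding) (MvPowerSeries.renameEquiv k e F) = F from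
      (MvPowerSeries.renameEquiv k e).symm_apply_apply F] at h1
    exact h1.symm
  simp_rw [h]
  exact MvPowerSeries.WithPiTopology.continuous_coeff k _

theorem renameEquiv_formalProd {σ ι k : Type*} [Field k] (e : σ ≃ σ)
    (f : ι → MvPowerSeries σ k) :
    MvPowerSeries.renameEquiv k e (formalProd f) =
      formalProd fun i => MvPowerSeries.renameEquiv k e (f i) := by
  let : TopologicalSpace k := ⊥
  have : DiscreteTopology k := ⟨rfl⟩
  exact Function.LeftInverse.map_tprod f (continuous_renameEquiv e)
    (g' := MvPowerSeries.renameEquiv k e.symm) (continuous_renameEquiv e.symm)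
    (MvPowerSeries.renameEquiv k e).symm_apply_apply

theorem renameEquiv_inv {σ k : Type*} [Field k] (e : σ ≃ σ) (F : MvPowerSeries σ k) :
    MvPowerSeries.renameEquiv k e F⁻¹ = (MvPowerSeries.renameEquiv k e F)⁻¹ := by
  by_cases h : MvPowerSeries.constantCoeff F = 0
  · rw [MvPowerSeries.inv_eq_zero.mpr h, map_zero, eq_comm, MvPowerSeries.inv_eq_zero]
    simpa using h
  · rw [MvPowerSeries.eq_inv_iff_mul_eq_one (by simpa using h), ← map_mul,
      MvPowerSeries.inv_mul_cancel _ h, map_one]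

theorem formalProd_mem_symmSeries {P k ι : Type*} [Field k]
    {f : ι → MvPowerSeries (P × ℕ) k} (hf : ∀ i, f i ∈ symmSeries P k) :
    formalProd f ∈ symmSeries P k := by
  intro π
  rw [renameEquiv_formalProd]
  congr 1
  funext i
  exact hf i π

/-- `∏_{i ≥ 1} g(x_i^(q))⁻¹` for a polynomial `g` in one variable. -/
def alphabetProd {P k : Type*} [Field k] (q : P) (g : Polynomial k) : MvPowerSeries (P × ℕ) k :=
  formalProd fun i : ℕ => (Polynomial.aeval (MvPowerSeries.X (q, i)) g)⁻¹

theorem alphabetProd_mem_symmSeries {P k : Type*} [Field k] (q : P) (g : Polynomial k) :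
    alphabetProd q g ∈ symmSeries P k := by
  intro π
  rw [alphabetProd, renameEquiv_formalProd]
  have h : ∀ i : ℕ, MvPowerSeries.renameEquiv k (Equiv.prodCongrRight π)
      (Polynomial.aeval (MvPowerSeries.X (q, i)) g)⁻¹ =
      (Polynomial.aeval (MvPowerSeries.X (q, π q i) : MvPowerSeries (P × ℕ) k) g)⁻¹ := by
    intro i
    rw [renameEquiv_inv, ← Polynomial.aeval_algHom_apply]
    simp
  simp_rw [h]
  let : TopologicalSpace k := ⊥
  exact (π q).tprod_eq
    (fun i => (Polynomial.aeval (MvPowerSeries.X (q, i) : MvPowerSeries (P × ℕ) k) g)⁻¹)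

theorem aeval_mem_unipotentOn {P k : Type*} [Field k] (v : P) {g : Polynomial k}
    (hg : g.coeff 0 = 1) :
    Polynomial.aeval (MvPowerSeries.X v : MvPowerSeries P k) g ∈ unipotentOn k {v} := by
  classical
  have h : ∀ n : ℕ, ∀ e : P →₀ ℕ, MvPowerSeries.coeff e
      ((MvPowerSeries.X v : MvPowerSeries P k) ^ n) = if e = Finsupp.single v n then 1 else 0 :=
    fun n e => MvPowerSeries.coeff_X_pow e v n
  constructor
  · have := Polynomial.hom_eval₂ g (algebraMap k (MvPowerSeries P k))
      (MvPowerSeries.constantCoeff (σ := P) (R := k)) (MvPowerSeries.X v)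
    rw [MvPowerSeries.constantCoeff_X] at this
    rw [Polynomial.aeval_def, this, Polynomial.eval₂_at_zero, hg, map_one]
  · intro e he
    rw [Polynomial.aeval_eq_sum_range, map_sum] at he
    obtain ⟨n, _, hn⟩ := Finset.exists_ne_zero_of_sum_ne_zero he
    rw [map_smul, h] at hn
    have : e = Finsupp.single v n := by by_contra h'; simp [h'] at hn
    rw [this]
    exact fun i hi => by simpa using Finsupp.support_single_subset hi

theorem formallyMultipliable_alphabetProd {P k : Type*} [Field k] (q : P) {g : Polynomial k}
    (hg : g.coeff 0 = 1) : FormallyMultipliable fun i : ℕ =>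
      (Polynomial.aeval (MvPowerSeries.X (q, i) : MvPowerSeries (P × ℕ) k) g)⁻¹ := by
  refine .of_mem_unipotentOn (s := fun i => {(q, i)}) (fun i j h => ?_)
    fun i => inv_mem_unipotentOn (aeval_mem_unipotentOn _ hg)
  simpa [Function.onFun] using h

theorem alphabetProd_mem_unipotentOn {P k : Type*} [Field k] (q : P) {g : Polynomial k}
    (hg : g.coeff 0 = 1) : alphabetProd q g ∈ unipotentOn k {v : P × ℕ | v.1 = q} := by
  refine formalProd_mem_unipotentOn (fun i => ?_) (formallyMultipliable_alphabetProd q hg)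
  have := inv_mem_unipotentOn (aeval_mem_unipotentOn (q, i) hg)
  exact ⟨this.1, fun e he => (this.2 e he).trans (by simp)⟩

theorem FormallyMultipliable.of_alphabets {P k : Type*} [Field k]
    {f : P → MvPowerSeries (P × ℕ) k} (hf : ∀ q, f q ∈ unipotentOn k {v : P × ℕ | v.1 = q}) :
    FormallyMultipliable f := by
  refine .of_mem_unipotentOn (fun q q' h => ?_) hf
  exact Set.disjoint_left.mpr fun v hv hv' => h (hv.symm.trans hv')

/-! ### The coefficient field `ℚ^ab` and the ring of arithmetic symmetric functions -/

/-- The maximal abelian extension of `ℚ` inside `ℂ`. -/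
def QAb : IntermediateField ℚ ℂ :=
  ⨆ E : {E : IntermediateField ℚ ℂ // IsAbelianGalois ℚ E}, E.1

theorem mem_QAb_of_pow_eq_one {z : ℂ} {n : ℕ} (hn : n ≠ 0) (hz : z ^ n = 1) : z ∈ QAb := by
  have hfin : IsOfFinOrder z := isOfFinOrder_iff_pow_eq_one.mpr ⟨n, Nat.pos_of_ne_zero hn, hz⟩
  have hpr : IsPrimitiveRoot z (orderOf z) := IsPrimitiveRoot.orderOf z
  have : NeZero (orderOf z) := ⟨hfin.orderOf_pos.ne'⟩
  have hint : IsIntegral ℚ z := ⟨Polynomial.X ^ n - 1, Polynomial.monic_X_pow_sub_C 1 hn, by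
    simp [hz]⟩
  have hcyc : IsCyclotomicExtension {orderOf z} ℚ (IntermediateField.adjoin ℚ {z}) := by
    change IsCyclotomicExtension {orderOf z} ℚ (IntermediateField.adjoin ℚ {z}).toSubalgebra
    rw [IntermediateField.adjoin_simple_toSubalgebra_of_isAlgebraic hint.isAlgebraic]
    exact hpr.adjoin_isCyclotomicExtension ℚ
  have hab : IsAbelianGalois ℚ (IntermediateField.adjoin ℚ {z}) :=
    IsCyclotomicExtension.isAbelianGalois {orderOf z} ℚ _
  have hle : IntermediateField.adjoin ℚ {z} ≤ QAb :=
    le_iSup (fun E : {E : IntermediateField ℚ ℂ // IsAbelianGalois ℚ E} => E.1) ⟨_, hab⟩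
  exact hle (IntermediateField.mem_adjoin_simple_self ℚ z)

/-- The ring `𝒜_K` of arithmetic symmetric functions of the number field `K`, over `ℚ^ab`, with one
alphabet for each nonzero prime of `K`. -/
abbrev ArithSymmRing (K : Type*) [Field K] [NumberField K] :
    Subalgebra QAb (MvPowerSeries (IsDedekindDomain.HeightOneSpectrum (𝓞 K) × ℕ) QAb) :=
  symmSeries (IsDedekindDomain.HeightOneSpectrum (𝓞 K)) QAb

/-! ### Dedekind symmetric functions -/

/-- `ζ_K = ∏_q ∏_i (1 - x_i^(q))⁻¹`. -/
def dedekind (K : Type*) [Field K] [NumberField K] : ArithSymmRing K :=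
  ⟨formalProd fun q : IsDedekindDomain.HeightOneSpectrum (𝓞 K) => alphabetProd q (1 - Polynomial.X),
    formalProd_mem_symmSeries fun q => alphabetProd_mem_symmSeries q _⟩

/-- `ζ_{L/K} = ∏_q ∏_{p ∣ q} ∏_i (1 - (x_i^(q))^{f(p|q)})⁻¹`. -/
def relDedekind (K L : Type*) [Field K] [NumberField K] [Field L] [NumberField L]
    [Algebra K L] : ArithSymmRing K :=
  ⟨formalProd fun q : IsDedekindDomain.HeightOneSpectrum (𝓞 K) =>
      ∏ p ∈ IsDedekindDomain.primesOverFinset q.asIdeal (𝓞 L),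
        alphabetProd q (1 - Polynomial.X ^ p.inertiaDeg (𝓞 K)),
    formalProd_mem_symmSeries fun q =>
      Subalgebra.prod_mem _ fun _ _ => alphabetProd_mem_symmSeries q _⟩

theorem formallyMultipliable_dedekind (K : Type*) [Field K] [NumberField K] :
    FormallyMultipliable fun q : IsDedekindDomain.HeightOneSpectrum (𝓞 K) =>
      alphabetProd (k := QAb) q (1 - Polynomial.X) :=
  .of_alphabets fun q => alphabetProd_mem_unipotentOn q (by simp)

theorem inertiaDeg_ne_zero_of_mem {K L : Type*} [Field K] [NumberField K] [Field L]
    [NumberField L] [Algebra K L] (q : IsDedekindDomain.HeightOneSpectrum (𝓞 K)) {p : Ideal (𝓞 L)}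
    (hp : p ∈ IsDedekindDomain.primesOverFinset q.asIdeal (𝓞 L)) : p.inertiaDeg (𝓞 K) ≠ 0 := by
  have := q.isMaximal
  have h := (IsDedekindDomain.mem_primesOverFinset_iff q.ne_bot (𝓞 L)).mp hp
  have := h.1
  exact (p.inertiaDeg_pos (𝓞 K)).ne'

theorem formallyMultipliable_relDedekind (K L : Type*) [Field K] [NumberField K] [Field L]
    [NumberField L] [Algebra K L] :
    FormallyMultipliable fun q : IsDedekindDomain.HeightOneSpectrum (𝓞 K) =>
      ∏ p ∈ IsDedekindDomain.primesOverFinset q.asIdeal (𝓞 L),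
        alphabetProd (k := QAb) q (1 - Polynomial.X ^ p.inertiaDeg (𝓞 K)) :=
  .of_alphabets fun q => Submonoid.prod_mem _ fun p hp => alphabetProd_mem_unipotentOn q (by
    simp [Polynomial.coeff_X_pow, (inertiaDeg_ne_zero_of_mem q hp).symm])

/-! ### Artin symmetric functions -/

/-- For each nonzero prime `q` of `K`, a choice of a prime of `L` over `q` and of a Frobenius
element at that prime. -/
structure FrobeniusChoice (K L : Type*) [Field K] [NumberField K] [Field L] [NumberField L]
    [Algebra K L] [IsGalois K L] where
  /-- the prime `𝔭 ∣ q` -/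
  primeOver : IsDedekindDomain.HeightOneSpectrum (𝓞 K) → Ideal (𝓞 L)
  isPrime : ∀ q, (primeOver q).IsPrime
  liesOver : ∀ q, (primeOver q).LiesOver q.asIdeal
  /-- a representative in `Gal(L/K)` of the Frobenius `σ_q ∈ D(q)/I(q)` -/
  frob : IsDedekindDomain.HeightOneSpectrum (𝓞 K) → Gal(L/K)
  isArithFrobAt : ∀ q, IsArithFrobAt (𝓞 K) (frob q) (primeOver q)

section Artin

variable {K L : Type*} [Field K] [NumberField K] [Field L] [NumberField L] [Algebra K L]
  [IsGalois K L]

instance : Nonempty (FrobeniusChoice K L) := by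
  have h : ∀ q : IsDedekindDomain.HeightOneSpectrum (𝓞 K), ∃ (p : Ideal (𝓞 L)) (σ : Gal(L/K)),
      p.IsPrime ∧ p.LiesOver q.asIdeal ∧ IsArithFrobAt (𝓞 K) σ p := by
    intro q
    have := q.isMaximal
    obtain ⟨p, hp, hpq⟩ := Ideal.exists_maximal_ideal_liesOver_of_isIntegral q.asIdeal (S := 𝓞 L)
    have : p.IsPrime := hp.isPrime
    obtain ⟨σ, hσ⟩ := IsArithFrobAt.exists_of_isInvariant (𝓞 K) Gal(L/K) p
    exact ⟨p, σ, hp.isPrime, hpq, hσ⟩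
  choose p σ h1 h2 h3 using h
  exact ⟨⟨p, h1, h2, σ, h3⟩⟩

namespace FrobeniusChoice

variable (c : FrobeniusChoice K L) (q : IsDedekindDomain.HeightOneSpectrum (𝓞 K))

/-- The inertia group `I(q)` of the chosen prime over `q`. -/
def inertia : Subgroup Gal(L/K) := (c.primeOver q).inertia Gal(L/K)

theorem conj_mem_inertia {g : Gal(L/K)} (hg : g ∈ c.inertia q) :
    (c.frob q)⁻¹ * g * c.frob q ∈ c.inertia q := by
  have := c.isPrime q
  have key : ∀ y : 𝓞 L, c.frob q • y ∈ c.primeOver q → y ∈ c.primeOver q := fun y hy =>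
    (c.isPrime q).mem_of_pow_mem _ (by
      simpa using (c.primeOver q).sub_mem hy (c.isArithFrobAt q y))
  intro x
  refine key _ ?_
  have h := hg (c.frob q • x)
  rwa [smul_sub, mul_assoc, mul_smul, mul_smul, smul_inv_smul]

variable {V : Type*} [AddCommGroup V] [Module ℂ V] (ρ : Representation ℂ Gal(L/K) V)

/-- The subspace `V^{I(q)}` of inertia invariants. -/
def inertiaInvariants : Submodule ℂ V :=
  Representation.invariants (ρ.comp (c.inertia q).subtype)

theorem frob_mem_inertiaInvariants (v : V) (hv : v ∈ c.inertiaInvariants q ρ) :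
    ρ (c.frob q) v ∈ c.inertiaInvariants q ρ := by
  rintro ⟨g, hg⟩
  have h := hv ⟨_, c.conj_mem_inertia q hg⟩
  change ρ ((c.frob q)⁻¹ * g * c.frob q) v = v at h
  change ρ g (ρ (c.frob q) v) = ρ (c.frob q) v
  conv_rhs => rw [← h]
  rw [← Module.End.mul_apply, ← Module.End.mul_apply, ← map_mul, ← map_mul]
  congr 2
  group

/-- The action `ρ(σ_q)|_{V^{I(q)}}` of Frobenius on the inertia invariants. -/
def frobAction : c.inertiaInvariants q ρ →ₗ[ℂ] c.inertiaInvariants q ρ :=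
  (ρ (c.frob q)).restrict (c.frob_mem_inertiaInvariants q ρ)

variable [FiniteDimensional ℂ V]

/-- `f_q(x) = det(Id - x ρ(σ_q)|_{V^{I(q)}})`, a polynomial with complex coefficients. -/
def frobDet : Polynomial ℂ :=
  (LinearMap.toMatrix (Module.finBasis ℂ (c.inertiaInvariants q ρ))
    (Module.finBasis ℂ (c.inertiaInvariants q ρ)) (c.frobAction q ρ)).charpolyRev

/-- The coefficients of `f_q(x)` lie in `ℚ^ab`. -/
theorem exists_map_eq_frobDet :
    ∃ f : Polynomial QAb, f.map (algebraMap QAb ℂ) = c.frobDet q ρ := by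
  set T := c.frobAction q ρ with hT
  have hn0 : orderOf (c.frob q) ≠ 0 := (isOfFinOrder_of_finite (c.frob q)).orderOf_pos.ne'
  have hpow : T ^ orderOf (c.frob q) = 1 := by
    have h : ∀ (n : ℕ) (v : c.inertiaInvariants q ρ),
        ((T ^ n) v : V) = ρ (c.frob q ^ n) v := by
      intro n
      induction n with
      | zero => intro v; simp
      | succ n ih =>
        intro v
        rw [pow_succ, Module.End.mul_apply, ih, pow_succ, map_mul, Module.End.mul_apply]
        rfl
    ext v
    rw [h, pow_orderOf_eq_one]
    simp
  have hlift : T.charpoly ∈ Polynomial.lifts (algebraMap QAb ℂ) := by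
    rw [(IsAlgClosed.splits T.charpoly).eq_prod_roots_of_monic T.charpoly_monic]
    refine Subsemiring.multiset_prod_mem _ _ fun f hf => ?_
    obtain ⟨μ, hμ, rfl⟩ := Multiset.mem_map.mp hf
    have hroot : T.charpoly.IsRoot μ := (Polynomial.mem_roots'.mp hμ).2
    obtain ⟨v, hv⟩ := ((Module.End.hasEigenvalue_iff_isRoot_charpoly T μ).mpr
      hroot).exists_hasEigenvector
    have hμ1 : μ ^ orderOf (c.frob q) = 1 := by
      have h := hv.pow_apply (orderOf (c.frob q))
      rw [hpow, Module.End.one_apply] at h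
      have h' : (μ ^ orderOf (c.frob q) - 1) • v = 0 := by
        rw [sub_smul, one_smul, ← h, sub_self]
      exact sub_eq_zero.mp ((smul_eq_zero.mp h').resolve_right hv.2)
    exact ⟨Polynomial.X - Polynomial.C ⟨μ, mem_QAb_of_pow_eq_one hn0 hμ1⟩, by simp⟩
  obtain ⟨f, hf⟩ := Polynomial.mem_lifts _ |>.mp hlift
  refine ⟨f.reverse, ?_⟩
  have hdet : c.frobDet q ρ = T.charpoly.reverse := by
    rw [frobDet, ← Matrix.reverse_charpoly, LinearMap.charpoly_toMatrix]
  rw [hdet, ← hf, Polynomial.reverse, Polynomial.reverse, Polynomial.reflect_map,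
    Polynomial.natDegree_map]

/-- `f_q(x) = det(Id - x ρ(σ_q)|_{V^{I(q)}})` as a polynomial with coefficients in `ℚ^ab`. -/
def frobPoly : Polynomial QAb := (c.exists_map_eq_frobDet q ρ).choose

theorem map_frobPoly : (c.frobPoly q ρ).map (algebraMap QAb ℂ) = c.frobDet q ρ :=
  (c.exists_map_eq_frobDet q ρ).choose_spec

theorem coeff_zero_frobPoly : (c.frobPoly q ρ).coeff 0 = 1 := by
  apply (algebraMap QAb ℂ).injective
  rw [← Polynomial.coeff_map, map_frobPoly, frobDet, Polynomial.coeff_zero_eq_eval_zero,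
    Matrix.eval_charpolyRev, map_one]

end FrobeniusChoice

/-- The Artin symmetric function
`ℒ(ρ; L/K) = ∏_q ∏_i det(Id - x_i^(q) ρ(σ_q)|_{V^{I(q)}})⁻¹`. -/
def artin (c : FrobeniusChoice K L) {V : Type*} [AddCommGroup V] [Module ℂ V]
    [FiniteDimensional ℂ V] (ρ : Representation ℂ Gal(L/K) V) : ArithSymmRing K :=
  ⟨formalProd fun q : IsDedekindDomain.HeightOneSpectrum (𝓞 K) => alphabetProd q (c.frobPoly q ρ),
    formalProd_mem_symmSeries fun q => alphabetProd_mem_symmSeries q _⟩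

theorem formallyMultipliable_artin (c : FrobeniusChoice K L) {V : Type*} [AddCommGroup V]
    [Module ℂ V] [FiniteDimensional ℂ V] (ρ : Representation ℂ Gal(L/K) V) :
    FormallyMultipliable fun q : IsDedekindDomain.HeightOneSpectrum (𝓞 K) => alphabetProd q (c.frobPoly q ρ) :=
  .of_alphabets fun q => alphabetProd_mem_unipotentOn q (c.coeff_zero_frobPoly q ρ)

end Artin

/-- The family `ρ` represents each equivalence class of nontrivial irreducible finite dimensional
complex representations of `G` exactly once. -/
structure RepresentsNontrivialIrreps {G : Type*} [Group G] {ι : Type*} {V : ι → Type*}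
    [∀ i, AddCommGroup (V i)] [∀ i, Module ℂ (V i)] (ρ : ∀ i, Representation ℂ G (V i)) :
    Prop where
  irreducible : ∀ i, (ρ i).IsIrreducible
  nontrivial : ∀ i, ¬ Nonempty ((ρ i).Equiv (Representation.trivial ℂ G ℂ))
  injective : ∀ i j, Nonempty ((ρ i).Equiv (ρ j)) → i = j
  complete : ∀ (n : ℕ) (τ : Representation ℂ G (Fin n → ℂ)), τ.IsIrreducible →
    ¬ Nonempty (τ.Equiv (Representation.trivial ℂ G ℂ)) → ∃ i, Nonempty (τ.Equiv (ρ i))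

end

end ArithSymm

/-!
The alphabets of different primes do not interact, and formal products are multiplicative, so it
suffices to compare Euler factors. At a prime `q` with `g` primes above it, all of residue degree
`f`, the claim is the polynomial identity
`(1 - Xᶠ)ᵍ = (1 - X) ∏_ρ det(1 - X ρ(σ_q) | V^I) ^ dim ρ`
(`FrobeniusChoice.prod_one_sub_X_pow_inertiaDeg`).

Since `σ_qᶠ ∈ I`, the Frobenius acts on `V^I` with `f`-th power `1`, and its characteristic
polynomial is the product of the `X - ζ`, `ζᶠ = 1`, to the power `dim` of the `ζ`-eigenspace
(`charpoly_eq_prod_of_pow_eq_one`). That dimension is the trace on `V` of an element `e_ζ` of the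
group algebra (`eigenProjector`, `FrobeniusChoice.trace_eigenProjector`).

For every element `a` of the group algebra, the traces of `a` on the irreducible representations,
weighted by their dimensions, add up to the trace on the regular representation, which is `|G|`
times the coefficient of `a` at `1` (`RepresentsNontrivialIrreps.trace_regular`). This follows from
the decomposition of the regular representation into simple modules, in which Schur's lemma gives
each simple module a multiplicity equal to its dimension; it also shows that there are only finitely
many irreducible representations. For `a = e_ζ` the coefficient at `1` is `1 / (f |I|)`, because no
`σ_qᵏ` with `0 < k < f` lies in `I` (`FrobeniusChoice.frob_pow_mem_inertia_iff`), and
`|G| = g |I| f`. So every `f`-th root of unity `ζ` occurs with total multiplicity `g` on the right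
hand side, as it does on the left.
-/

open NumberField
open scoped MvPowerSeries.WithPiTopology

namespace ArithSymm

noncomputable section

/-! ### Multiplicativity of formal products -/

theorem formalProd_mul {σ ι k : Type*} [Field k] {f g : ι → MvPowerSeries σ k}
    (hf : FormallyMultipliable f) (hg : FormallyMultipliable g) :
    formalProd (fun i => f i * g i) = formalProd f * formalProd g := by
  let : TopologicalSpace k := ⊥
  have : DiscreteTopology k := ⟨rfl⟩
  exact Multipliable.tprod_mul hf hg

theorem FormallyMultipliable.mul {σ ι k : Type*} [Field k] {f g : ι → MvPowerSeries σ k}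
    (hf : FormallyMultipliable f) (hg : FormallyMultipliable g) :
    FormallyMultipliable fun i => f i * g i := by
  let : TopologicalSpace k := ⊥
  have : DiscreteTopology k := ⟨rfl⟩
  exact Multipliable.mul hf hg

theorem formalProd_one {σ ι k : Type*} [Field k] :
    formalProd (fun _ : ι => (1 : MvPowerSeries σ k)) = 1 := by
  let : TopologicalSpace k := ⊥
  exact tprod_one

theorem formallyMultipliable_one {σ ι k : Type*} [Field k] :
    FormallyMultipliable (fun _ : ι => (1 : MvPowerSeries σ k)) := by
  let : TopologicalSpace k := ⊥
  exact multipliable_one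

theorem formalProd_prod {σ ι κ k : Type*} [Field k] (s : Finset κ)
    {f : κ → ι → MvPowerSeries σ k} (hf : ∀ j ∈ s, FormallyMultipliable (f j)) :
    FormallyMultipliable (fun i => ∏ j ∈ s, f j i) ∧
      formalProd (fun i => ∏ j ∈ s, f j i) = ∏ j ∈ s, formalProd (f j) := by
  classical
  induction s using Finset.induction_on with
  | empty => simpa using ⟨formallyMultipliable_one, formalProd_one⟩
  | insert a s ha ih =>
    obtain ⟨h1, h2⟩ := ih fun j hj => hf j (Finset.mem_insert_of_mem hj)
    have h3 := hf a (Finset.mem_insert_self a s)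
    simp only [Finset.prod_insert ha]
    exact ⟨h3.mul h1, by rw [formalProd_mul h3 h1, h2]⟩

theorem formalProd_pow {σ ι k : Type*} [Field k] {f : ι → MvPowerSeries σ k}
    (hf : FormallyMultipliable f) (n : ℕ) :
    FormallyMultipliable (fun i => f i ^ n) ∧ formalProd (fun i => f i ^ n) = formalProd f ^ n := by
  simpa using formalProd_prod (Finset.range n) (f := fun _ => f) fun _ _ => hf

theorem alphabetProd_mul {P k : Type*} [Field k] (q : P) {g h : Polynomial k}
    (hg : g.coeff 0 = 1) (hh : h.coeff 0 = 1) :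
    alphabetProd q (g * h) = alphabetProd q g * alphabetProd q h := by
  simp only [alphabetProd]
  rw [← formalProd_mul (formallyMultipliable_alphabetProd q hg)
    (formallyMultipliable_alphabetProd q hh)]
  simp [MvPowerSeries.mul_inv_rev, mul_comm]

theorem alphabetProd_one {P k : Type*} [Field k] (q : P) :
    alphabetProd q (1 : Polynomial k) = 1 := by
  simp [alphabetProd, formalProd_one]

theorem alphabetProd_prod {P k κ : Type*} [Field k] (q : P) (s : Finset κ) {g : κ → Polynomial k}
    (hg : ∀ j ∈ s, (g j).coeff 0 = 1) :
    alphabetProd q (∏ j ∈ s, g j) = ∏ j ∈ s, alphabetProd q (g j) := by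
  classical
  induction s using Finset.induction_on with
  | empty => simp [alphabetProd_one]
  | insert a s ha ih =>
    have h := fun j hj => hg j (Finset.mem_insert_of_mem hj)
    rw [Finset.prod_insert ha, Finset.prod_insert ha, ← ih h,
      alphabetProd_mul q (hg a (Finset.mem_insert_self a s))]
    rw [Polynomial.coeff_zero_prod, Finset.prod_congr rfl h, Finset.prod_const_one]

theorem alphabetProd_pow {P k : Type*} [Field k] (q : P) {g : Polynomial k}
    (hg : g.coeff 0 = 1) (n : ℕ) : alphabetProd q (g ^ n) = alphabetProd q g ^ n := by
  simpa using alphabetProd_prod q (Finset.range n) (g := fun _ => g) fun _ _ => hg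

/-! ### Multiplicities and traces in the regular module -/

open Module Polynomial
open scoped MonoidAlgebra

/-- Schur's lemma, as a formula for the dimension of a space of homomorphisms. -/
theorem finrank_hom_of_isSimpleModule (k : Type*) {A S W : Type*} [Field k] [IsAlgClosed k]
    [Ring A] [Algebra k A] [AddCommGroup S] [Module k S] [Module A S] [IsScalarTower k A S]
    [AddCommGroup W] [Module k W] [Module A W] [IsScalarTower k A W]
    [IsSimpleModule A S] [IsSimpleModule A W] [FiniteDimensional k W]
    [Decidable (Nonempty (S ≃ₗ[A] W))] :
    finrank k (S →ₗ[A] W) = if Nonempty (S ≃ₗ[A] W) then 1 else 0 := by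
  split_ifs with h
  · obtain ⟨e⟩ := h
    have h1 := IsSimpleModule.algebraMap_end_bijective_of_isAlgClosed (A := A) (V := W) k
    let e1 : k ≃ₗ[k] Module.End A W := LinearEquiv.ofBijective (Algebra.linearMap k _) h1
    let e2 : (S →ₗ[A] W) ≃ₗ[k] (W →ₗ[A] W) :=
      { toFun := fun f => f ∘ₗ e.symm.toLinearMap
        invFun := fun f => f ∘ₗ e.toLinearMap
        map_add' := fun _ _ => rfl
        map_smul' := fun _ _ => rfl
        left_inv := fun f => by ext; simp
        right_inv := fun f => by ext; simp }
    rw [(e2.trans e1.symm).finrank_eq, finrank_self]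
  · have : Subsingleton (S →ₗ[A] W) := by
      refine subsingleton_of_forall_eq 0 fun f => ?_
      exact (LinearMap.bijective_or_eq_zero f).resolve_left fun hf =>
        h ⟨LinearEquiv.ofBijective f hf⟩
    exact finrank_zero_of_subsingleton

/-- A simple module `W` occurs in the regular module `A` with multiplicity `dim W`: compute
`Hom_A(A, W) = W` by means of a decomposition of `A` into simple modules. -/
theorem card_simple_factors_eq_finrank (k : Type*) {A ι W : Type*} [Field k] [IsAlgClosed k]
    [Ring A] [Algebra k A] [Fintype ι] {S : ι → Submodule A A} [∀ j, IsSimpleModule A (S j)]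
    (e : A ≃ₗ[A] Π₀ j, S j)
    [AddCommGroup W] [Module k W] [Module A W] [IsScalarTower k A W]
    [IsSimpleModule A W] [FiniteDimensional k W] [DecidablePred fun j => Nonempty (S j ≃ₗ[A] W)] :
    (Finset.univ.filter fun j => Nonempty (S j ≃ₗ[A] W)).card = finrank k W := by
  classical
  let e1 : W ≃ₗ[k] (A →ₗ[A] W) := (LinearMap.ringLmapEquivSelf A k W).symm
  let e2 : (A →ₗ[A] W) ≃ₗ[k] ((Π₀ j, S j) →ₗ[A] W) :=
      { toFun := fun f => f ∘ₗ e.symm.toLinearMap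
        invFun := fun f => f ∘ₗ e.toLinearMap
        map_add' := fun _ _ => rfl
        map_smul' := fun _ _ => rfl
        left_inv := fun f => by ext; simp
        right_inv := fun f => by ext; simp }
  let e3 : ((j : ι) → S j →ₗ[A] W) ≃ₗ[k] ((Π₀ j, S j) →ₗ[A] W) := DFinsupp.lsum k
  have hfin : ∀ j, FiniteDimensional k (S j →ₗ[A] W) := by
    intro j
    have h1 : FiniteDimensional k ((j : ι) → S j →ₗ[A] W) :=
      ((e1.trans e2).trans e3.symm).finiteDimensional
    exact FiniteDimensional.of_surjective
      (LinearMap.proj (R := k) (φ := fun j => S j →ₗ[A] W) j) (LinearMap.proj_surjective j)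
  rw [((e1.trans e2).trans e3.symm).finrank_eq, finrank_pi_fintype, Finset.card_filter]
  exact Finset.sum_congr rfl fun j _ => (finrank_hom_of_isSimpleModule k).symm

theorem trace_lsmul_eq_sum (k : Type*) {A M ι : Type*} [Field k] [Ring A]
    [Algebra k A] [Fintype ι] {S : ι → Type*} [∀ j, AddCommGroup (S j)] [∀ j, Module k (S j)]
    [∀ j, Module A (S j)] [∀ j, IsScalarTower k A (S j)]
    [AddCommGroup M] [Module k M] [Module A M] [IsScalarTower k A M] [FiniteDimensional k M]
    [∀ j, FiniteDimensional k (S j)]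
    (e : M ≃ₗ[A] Π₀ j, S j) (a : A) :
    LinearMap.trace k M (Algebra.lsmul k k M a) =
      ∑ j, LinearMap.trace k (S j) (Algebra.lsmul k k (S j) a) := by
  classical
  let inc : ∀ j, S j →ₗ[k] M := fun j =>
    (e.symm.toLinearMap ∘ₗ DFinsupp.lsingle j).restrictScalars k
  let pr : ∀ j, M →ₗ[k] S j := fun j => (DFinsupp.lapply j ∘ₗ e.toLinearMap).restrictScalars k
  have h1 : Algebra.lsmul k k M a = ∑ j, (inc j ∘ₗ Algebra.lsmul k k (S j) a) ∘ₗ pr j := by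
    ext m
    apply e.injective
    rw [LinearMap.sum_apply, map_sum]
    ext j
    simp [inc, pr, DFinsupp.single_apply]
  rw [h1, map_sum]
  refine Finset.sum_congr rfl fun j _ => ?_
  -- Cyclicity turns the trace on `M` into the trace of `pr j ∘ inc j ∘ a = a` on `S j`.
  rw [LinearMap.trace_comp_comm']
  congr 1
  ext m
  simp [inc, pr]

theorem trace_lsmul_congr (k : Type*) {A M N : Type*} [Field k] [Ring A]
    [Algebra k A] [AddCommGroup M] [Module k M] [Module A M] [IsScalarTower k A M]
    [AddCommGroup N] [Module k N] [Module A N] [IsScalarTower k A N]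
    (e : M ≃ₗ[A] N) (a : A) :
    LinearMap.trace k M (Algebra.lsmul k k M a) = LinearMap.trace k N (Algebra.lsmul k k N a) := by
  rw [← LinearMap.trace_conj' _ (e.restrictScalars k)]
  congr 1
  ext m
  simp [LinearEquiv.conj_apply]

theorem trace_lsmul_monoidAlgebra {k G : Type*} [Field k] [Group G] [Fintype G] (a : k[G]) :
    LinearMap.trace k k[G] (Algebra.lsmul k k k[G] a) = Fintype.card G * a.coeff 1 := by
  classical
  let b := MonoidAlgebra.basis G k
  rw [LinearMap.trace_eq_matrix_trace k b, Matrix.trace]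
  have : ∀ g, (LinearMap.toMatrix b b (Algebra.lsmul k k k[G] a)).diag g = a.coeff 1 := by
    intro g
    have hb : b g = MonoidAlgebra.single g 1 := rfl
    rw [Matrix.diag_apply, LinearMap.toMatrix_apply, hb]
    change (a * MonoidAlgebra.single g 1).coeff g = _
    simp
  rw [Finset.sum_congr rfl fun g _ => this g]
  simp

/-! ### The regular representation of a finite group -/

section
variable {k G V W : Type*} [Field k] [Group G] [AddCommGroup V] [Module k V] [AddCommGroup W]
  [Module k W]

theorem nonempty_equiv_iff_asModule (ρ : Representation k G V) (σ : Representation k G W) :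
    Nonempty (ρ.Equiv σ) ↔ Nonempty (ρ.asModule ≃ₗ[k[G]] σ.asModule) := by
  constructor
  · rintro ⟨φ⟩
    exact ⟨LinearEquiv.ofBijective
      (Representation.IntertwiningMap.equivLinearMapAsModule ρ σ φ.toIntertwiningMap)
      φ.toLinearEquiv.bijective⟩
  · rintro ⟨e⟩
    exact ⟨Representation.IntertwiningMap.ofBijective
      ((Representation.IntertwiningMap.equivLinearMapAsModule ρ σ).symm e.toLinearMap) e.bijective⟩

theorem trace_lsmul_asModule (ρ : Representation k G V) (a : k[G]) :
    LinearMap.trace k ρ.asModule (Algebra.lsmul k k ρ.asModule a) =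
      LinearMap.trace k V (ρ.asAlgebraHom a) := by
  rw [← LinearMap.trace_conj' _ ρ.asModuleEquiv]
  congr 1

/-- A finite dimensional module over the group algebra comes from a representation on some `kⁿ`, the
shape in which `RepresentsNontrivialIrreps.complete` asks for it. -/
theorem exists_linearEquiv_asModule (S : Type*) [AddCommGroup S] [Module k S] [Module k[G] S]
    [IsScalarTower k k[G] S] [FiniteDimensional k S] :
    ∃ τ : Representation k G (Fin (finrank k S) → k), Nonempty (S ≃ₗ[k[G]] τ.asModule) := by
  let b := (finBasis k S).equivFun
  let φ : k[G] →ₐ[k] End k (Fin (finrank k S) → k) :=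
    (b.conjAlgEquiv k).toAlgHom.comp (Algebra.lsmul k k S)
  let τ : Representation k G (Fin (finrank k S) → k) := (MonoidAlgebra.lift k _ G).symm φ
  have hτ : τ.asAlgebraHom = φ := (MonoidAlgebra.lift k _ G).apply_symm_apply φ
  refine ⟨τ, ⟨{ (b.trans τ.asModuleEquiv.symm) with map_smul' := fun a s => ?_ }⟩⟩
  apply τ.asModuleEquiv.injective
  simp only [RingHom.id_apply]
  rw [Representation.asModuleEquiv_map_smul, hτ]
  simp [φ]

end

theorem isSimpleModule_of_restrictScalars (k : Type*) {A M : Type*} [Field k] [Ring A] [Algebra k A]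
    [AddCommGroup M] [Module k M] [Module A M] [IsScalarTower k A M] [IsSimpleModule k M] :
    IsSimpleModule A M := by
  have := IsSimpleModule.nontrivial k M
  rw [isSimpleModule_iff]
  refine { eq_bot_or_eq_top := fun N => ?_ }
  simpa using eq_bot_or_eq_top (N.restrictScalars k)

/-- There are finitely many irreducible representations, and the trace of `a` on the regular
representation, which is `|G|` times the coefficient of `a` at `1`, is the sum of its traces on the
irreducible representations, each weighted by its dimension; the trivial one, of dimension `1`, is
listed separately. -/
theorem RepresentsNontrivialIrreps.trace_regular {G : Type*} [Group G] [Finite G] {ι : Type*}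
    {V : ι → Type*} [∀ i, AddCommGroup (V i)] [∀ i, Module ℂ (V i)]
    [∀ i, FiniteDimensional ℂ (V i)] {ρ : ∀ i, Representation ℂ G (V i)}
    (hρ : RepresentsNontrivialIrreps ρ) :
    Finite ι ∧ ∀ [Fintype ι] (a : ℂ[G]),
      LinearMap.trace ℂ ℂ ((Representation.trivial ℂ G ℂ).asAlgebraHom a) +
        ∑ i, (finrank ℂ (V i) : ℂ) * LinearMap.trace ℂ (V i) ((ρ i).asAlgebraHom a) =
      Nat.card G * a.coeff 1 := by
  classical
  have : Fintype G := Fintype.ofFinite G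
  obtain ⟨n, S, e, hS⟩ := IsSemisimpleModule.exists_linearEquiv_fin_dfinsupp ℂ[G] ℂ[G]
  have hSfin : ∀ j, FiniteDimensional ℂ (S j) := fun j =>
    FiniteDimensional.of_injective ((S j).subtype.restrictScalars ℂ) Subtype.val_injective
  let T : Representation ℂ G ℂ := Representation.trivial ℂ G ℂ
  have hT : IsSimpleModule ℂ[G] T.asModule := by
    have : IsSimpleModule ℂ T.asModule := inferInstanceAs (IsSimpleModule ℂ ℂ)
    exact isSimpleModule_of_restrictScalars ℂ
  have hfT : FiniteDimensional ℂ T.asModule := inferInstanceAs (FiniteDimensional ℂ ℂ)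
  have hfV : ∀ i, FiniteDimensional ℂ (ρ i).asModule := fun i =>
    inferInstanceAs (FiniteDimensional ℂ (V i))
  have hV : ∀ i, IsSimpleModule ℂ[G] (ρ i).asModule := fun i =>
    (Representation.irreducible_iff_isSimpleModule_asModule _).mp (hρ.irreducible i)
  -- Sort the simple factors by isomorphism class, `none` standing for the trivial representation.
  have hclass : ∀ j, ∃ o : Option ι, match o with
      | none => Nonempty (S j ≃ₗ[ℂ[G]] T.asModule)
      | some i => Nonempty (S j ≃ₗ[ℂ[G]] (ρ i).asModule) := by
    intro j
    obtain ⟨τ, ⟨f⟩⟩ := exists_linearEquiv_asModule (k := ℂ) (G := G) (S j)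
    by_cases h : Nonempty (τ.Equiv T)
    · obtain ⟨f'⟩ := (nonempty_equiv_iff_asModule _ _).mp h
      exact ⟨none, ⟨f.trans f'⟩⟩
    · have : IsSimpleModule ℂ[G] τ.asModule := .congr f.symm
      obtain ⟨i, hi⟩ := hρ.complete _ τ
        ((Representation.irreducible_iff_isSimpleModule_asModule _).mpr this) h
      obtain ⟨f'⟩ := (nonempty_equiv_iff_asModule _ _).mp hi
      exact ⟨some i, ⟨f.trans f'⟩⟩
  choose κ hκ using hclass
  have hnone : ∀ j, κ j = none ↔ Nonempty (S j ≃ₗ[ℂ[G]] T.asModule) := by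
    intro j
    have := hκ j
    rcases h : κ j with _ | i
    · simpa [h] using this
    · simp only [h] at this
      obtain ⟨f⟩ := this
      simp only [reduceCtorEq, false_iff]
      rintro ⟨f'⟩
      exact hρ.nontrivial i ((nonempty_equiv_iff_asModule _ _).mpr ⟨f.symm.trans f'⟩)
  have hsome : ∀ j i, κ j = some i ↔ Nonempty (S j ≃ₗ[ℂ[G]] (ρ i).asModule) := by
    intro j i
    have := hκ j
    rcases h : κ j with _ | i'
    · simp only [h] at this
      obtain ⟨f⟩ := this
      simp only [reduceCtorEq, false_iff]
      rintro ⟨f'⟩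
      exact hρ.nontrivial i ((nonempty_equiv_iff_asModule _ _).mpr ⟨f'.symm.trans f⟩)
    · simp only [h] at this
      obtain ⟨f⟩ := this
      constructor
      · intro h'
        cases h'
        exact ⟨f⟩
      · rintro ⟨f'⟩
        rw [hρ.injective _ _ ((nonempty_equiv_iff_asModule _ _).mpr ⟨f.symm.trans f'⟩)]
  -- The number of simple factors in a class is the dimension of the corresponding representation.
  have cnone : (Finset.univ.filter fun j => κ j = none).card = 1 := by
    simp_rw [hnone]
    rw [card_simple_factors_eq_finrank ℂ e]
    exact finrank_self ℂ
  have csome : ∀ i, (Finset.univ.filter fun j => κ j = some i).card = finrank ℂ (V i) := by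
    intro i
    simp_rw [hsome]
    rw [card_simple_factors_eq_finrank ℂ e]
    rfl
  refine ⟨?_, ?_⟩
  · have : ∀ i, ∃ j, κ j = some i := by
      intro i
      have : Nontrivial (V i) := IsSimpleModule.nontrivial ℂ[G] (ρ i).asModule
      have h : 0 < finrank ℂ (V i) := finrank_pos
      rw [← csome i, Finset.card_pos] at h
      obtain ⟨j, hj⟩ := h
      exact ⟨j, by simpa using hj⟩
    choose j hj using this
    exact Finite.of_injective j fun i i' h => by
      have := hj i
      rw [h, hj i'] at this
      exact (Option.some.inj this).symm
  · intro _ a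
    rw [Nat.card_eq_fintype_card, ← trace_lsmul_monoidAlgebra, trace_lsmul_eq_sum ℂ e,
      ← Finset.sum_fiberwise Finset.univ κ, Fintype.sum_option]
    congr 1
    · rw [Finset.sum_congr rfl (g := fun _ => LinearMap.trace ℂ ℂ (T.asAlgebraHom a)),
        Finset.sum_const, cnone, one_smul]
      intro j hj
      obtain ⟨f⟩ := (hnone j).mp (Finset.mem_filter.mp hj).2
      rw [trace_lsmul_congr ℂ f, trace_lsmul_asModule]
    · refine Finset.sum_congr rfl fun i _ => ?_
      rw [Finset.sum_congr rfl (g := fun _ => LinearMap.trace ℂ (V i) ((ρ i).asAlgebraHom a)),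
        Finset.sum_const, csome, nsmul_eq_mul]
      intro j hj
      obtain ⟨f⟩ := (hsome j i).mp (Finset.mem_filter.mp hj).2
      rw [trace_lsmul_congr ℂ f, trace_lsmul_asModule]

/-! ### Characteristic polynomials of endomorphisms of finite order -/

/-- An endomorphism `T` with `T ^ f = 1`, `f` invertible, is semisimple, so the multiplicities
of the roots of its characteristic polynomial are the dimensions of the eigenspaces. -/
theorem charpoly_eq_prod_of_pow_eq_one {k V : Type*} [Field k] [IsAlgClosed k] [AddCommGroup V]
    [Module k V] [FiniteDimensional k V] (T : End k V) {f : ℕ} (hf : (f : k) ≠ 0)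
    (hT : T ^ f = 1) :
    T.charpoly = ∏ ζ ∈ nthRootsFinset f (1 : k), (X - C ζ) ^ finrank k (T.eigenspace ζ) := by
  classical
  have hf0 : 0 < f := Nat.pos_of_ne_zero (by rintro rfl; simp at hf)
  have hss : T.IsSemisimple := by
    refine End.isSemisimple_of_squarefree_aeval_eq_zero (p := X ^ f - 1) ?_ (by simp [hT])
    exact (separable_X_pow_sub_C (1 : k) hf one_ne_zero).squarefree
  have hroot : ∀ ζ, finrank k (T.eigenspace ζ) = rootMultiplicity ζ T.charpoly := fun ζ => by
    rw [← LinearMap.finrank_maxGenEigenspace_eq,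
      (End.isFinitelySemisimple_iff_isSemisimple.mpr hss).maxGenEigenspace_eq_eigenspace]
  simp_rw [hroot]
  conv_lhs => rw [(IsAlgClosed.splits T.charpoly).eq_prod_roots_of_monic T.charpoly_monic,
    prod_multiset_root_eq_finset_root]
  refine Finset.prod_subset (fun ζ hζ => ?_) fun ζ _ hζ => ?_
  · have hr : T.charpoly.IsRoot ζ := (mem_roots'.mp (Multiset.mem_toFinset.mp hζ)).2
    obtain ⟨v, hv⟩ := ((End.hasEigenvalue_iff_isRoot_charpoly T ζ).mpr hr).exists_hasEigenvector
    rw [mem_nthRootsFinset hf0]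
    have h := hv.pow_apply f
    rw [hT, End.one_apply] at h
    have h' : (ζ ^ f - 1) • v = 0 := by rw [sub_smul, one_smul, ← h, sub_self]
    exact sub_eq_zero.mp ((smul_eq_zero.mp h').resolve_right hv.2)
  · rw [Multiset.mem_toFinset, ← count_roots] at *
    rw [Multiset.count_eq_zero_of_notMem hζ, pow_zero]

theorem reverse_prod_of_domain {R κ : Type*} [CommRing R] [IsDomain R] (s : Finset κ)
    (p : κ → R[X]) :
    (∏ j ∈ s, p j).reverse = ∏ j ∈ s, (p j).reverse := by
  classical
  induction s using Finset.induction_on with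
  | empty => simpa using reverse_C (1 : R)
  | insert a s ha ih => rw [Finset.prod_insert ha, Finset.prod_insert ha, reverse_mul_of_domain, ih]

theorem reverse_pow_of_domain {R : Type*} [CommRing R] [IsDomain R] (p : R[X]) (n : ℕ) :
    (p ^ n).reverse = p.reverse ^ n := by
  simpa using reverse_prod_of_domain (Finset.range n) fun _ => p

theorem reverse_X_pow_sub_one {R : Type*} [CommRing R] [IsDomain R] (n : ℕ) :
    (X ^ n - 1 : R[X]).reverse = 1 - X ^ n := by
  have h : (X ^ n - 1 : R[X]).natDegree = n := by simpa using natDegree_X_pow_sub_C (r := (1 : R))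
  rw [reverse, h, reflect_sub, reflect_one, reflect_monomial, revAt_le le_rfl, Nat.sub_self,
    pow_zero]

/-! ### Eigenspace projectors in the group algebra -/

section Projector
variable {G : Type*} [Group G]

/-- The element `(f⁻¹ ∑_{k < f} ζ⁻ᵏ σᵏ) (|I|⁻¹ ∑_{h ∈ I} h)` of the group algebra, for
a finite subgroup `I` (for infinite `I` it is the junk value `0`). If `σ` normalizes `I`, `σᶠ ∈ I`
and `ζᶠ = 1`, it projects a representation onto the `ζ`-eigenspace of `σ` on the `I`-invariants. -/
def eigenProjector (σ : G) (I : Subgroup G) (f : ℕ) (ζ : ℂ) : ℂ[G] :=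
  ((f : ℂ)⁻¹ • ∑ k ∈ Finset.range f, (ζ⁻¹ • MonoidAlgebra.single σ (1 : ℂ)) ^ k) *
    ((Nat.card I : ℂ)⁻¹ • ∑ᶠ h : I, MonoidAlgebra.single (h : G) (1 : ℂ))

theorem coeff_one_eigenProjector [Finite G] {σ : G} {I : Subgroup G} {f : ℕ} (hf : 0 < f)
    (hσ : ∀ k, σ ^ k ∈ I ↔ f ∣ k) (ζ : ℂ) :
    (eigenProjector σ I f ζ).coeff 1 = (f : ℂ)⁻¹ * (Nat.card I : ℂ)⁻¹ := by
  classical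
  have : Fintype I := Fintype.ofFinite I
  rw [eigenProjector, finsum_eq_sum_of_fintype, smul_mul_smul_comm, Finset.sum_mul_sum]
  have h : ∀ k ∈ Finset.range f, ∀ h : I,
      (((ζ⁻¹ • MonoidAlgebra.single σ (1 : ℂ)) ^ k *
        MonoidAlgebra.single (h : G) (1 : ℂ) : ℂ[G]).coeff 1) =
      if k = 0 then (if h = 1 then 1 else 0) else 0 := by
    intro k hk h
    have h1 : ((ζ⁻¹ • MonoidAlgebra.single σ (1 : ℂ)) ^ k *
        MonoidAlgebra.single (h : G) (1 : ℂ) : ℂ[G]) =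
        MonoidAlgebra.single (σ ^ k * h) (ζ⁻¹ ^ k) := by
      rw [_root_.smul_pow, MonoidAlgebra.single_pow]
      simp
    rw [h1, MonoidAlgebra.coeff_single, Finsupp.single_apply]
    rcases eq_or_ne k 0 with rfl | hk0
    · simp
    · rw [if_neg hk0, if_neg]
      intro h2
      have h3 : σ ^ k ∈ I := by
        rw [mul_eq_one_iff_eq_inv.mp h2]
        exact I.inv_mem h.2
      exact hk0 (Nat.eq_zero_of_dvd_of_lt ((hσ k).mp h3) (Finset.mem_range.mp hk))
  simp only [MonoidAlgebra.coeff_smul, Finsupp.smul_apply, MonoidAlgebra.coeff_sum,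
    Finsupp.coe_finsetSum, Finset.sum_apply]
  rw [Finset.sum_congr rfl fun k hk => Finset.sum_congr rfl fun x _ => h k hk x]
  simp [hf]

variable {V : Type*} [AddCommGroup V] [Module ℂ V] (ρ : Representation ℂ G V)

theorem asAlgebraHom_eigenProjector (σ : G) (I : Subgroup G) [Fintype I] (f : ℕ) (ζ : ℂ) :
    ρ.asAlgebraHom (eigenProjector σ I f ζ) =
      ((f : ℂ)⁻¹ • ∑ k ∈ Finset.range f, (ζ⁻¹ • ρ σ) ^ k) *
        ((Nat.card I : ℂ)⁻¹ • ∑ h : I, ρ h) := by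
  rw [eigenProjector, finsum_eq_sum_of_fintype]
  simp only [map_mul, map_smul, map_sum, map_pow, Representation.asAlgebraHom_single, one_smul]

theorem sum_range_inv_pow_of_pow_eq_one {k : Type*} [Field k] {f : ℕ} {ζ : k} (hζ : ζ ^ f = 1)
    [DecidableEq k] : ∑ j ∈ Finset.range f, ζ⁻¹ ^ j = if ζ = 1 then (f : k) else 0 := by
  split_ifs with h
  · simp [h]
  · have h1 : ζ⁻¹ ≠ 1 := by simpa using h
    rw [geom_sum_eq h1, inv_pow, hζ]
    simp

theorem trace_trivial_eigenProjector [Finite G] (σ : G) (I : Subgroup G) {f : ℕ} (hf : 0 < f)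
    {ζ : ℂ} (hζ : ζ ^ f = 1) :
    LinearMap.trace ℂ ℂ ((Representation.trivial ℂ G ℂ).asAlgebraHom (eigenProjector σ I f ζ)) =
      if ζ = 1 then 1 else 0 := by
  have : Fintype I := Fintype.ofFinite I
  have hf' : (f : ℂ) ≠ 0 := by exact_mod_cast hf.ne'
  have hI : (Fintype.card I : ℂ) ≠ 0 := by exact_mod_cast Fintype.card_ne_zero
  have h1 : ∀ g, Representation.trivial ℂ G ℂ g = 1 := fun _ => rfl
  have h2 : ∑ k ∈ Finset.range f, ζ⁻¹ ^ k • (1 : End ℂ ℂ) =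
      (if ζ = 1 then (f : ℂ) else 0) • 1 := by
    rw [← Finset.sum_smul, sum_range_inv_pow_of_pow_eq_one hζ]
  have h3 : ∑ _h : I, (1 : End ℂ ℂ) = (Fintype.card I : ℂ) • 1 := by
    rw [Finset.sum_const, Finset.card_univ, Nat.cast_smul_eq_nsmul]
  rw [asAlgebraHom_eigenProjector]
  simp only [h1, _root_.smul_pow, one_pow, h2, h3, Nat.card_eq_fintype_card]
  rw [inv_smul_smul₀ hI, mul_one, map_smul, map_smul, LinearMap.trace_one]
  split_ifs <;> simp [hf']

end Projector

/-! ### The Frobenius on the inertia invariants -/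

namespace FrobeniusChoice

variable {K L : Type*} [Field K] [NumberField K] [Field L] [NumberField L] [Algebra K L]
  [IsGalois K L] (c : FrobeniusChoice K L) (q : IsDedekindDomain.HeightOneSpectrum (𝓞 K))

section Eigenspace

variable {V : Type*} [AddCommGroup V] [Module ℂ V] (ρ : Representation ℂ Gal(L/K) V)

theorem coe_frobAction_pow (n : ℕ) (v : c.inertiaInvariants q ρ) :
    ((c.frobAction q ρ ^ n) v : V) = (ρ (c.frob q) ^ n) v := by
  induction n with
  | zero => simp
  | succ n ih => rw [pow_succ', pow_succ', Module.End.mul_apply, Module.End.mul_apply, ← ih]; rfl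

theorem frobAction_pow_eq_one {f : ℕ} (hf : c.frob q ^ f ∈ c.inertia q) :
    c.frobAction q ρ ^ f = 1 := by
  ext v
  rw [coe_frobAction_pow, ← map_pow]
  exact v.2 ⟨_, hf⟩

/-- The trace of `e_ζ` is the multiplicity of `ζ` as an eigenvalue of Frobenius on the inertia
invariants, because `e_ζ` projects onto that eigenspace. -/
theorem trace_eigenProjector [FiniteDimensional ℂ V] {f : ℕ} (hf0 : 0 < f)
    (hf : c.frob q ^ f ∈ c.inertia q) {ζ : ℂ} (hζ : ζ ^ f = 1) :
    LinearMap.trace ℂ V (ρ.asAlgebraHom (eigenProjector (c.frob q) (c.inertia q) f ζ)) =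
      finrank ℂ (End.eigenspace (c.frobAction q ρ) ζ) := by
  classical
  have : Fintype (c.inertia q) := Fintype.ofFinite _
  set T : End ℂ (c.inertiaInvariants q ρ) := c.frobAction q ρ
  have hζ0 : ζ ≠ 0 := by rintro rfl; simp [hf0.ne'] at hζ
  have hf' : (f : ℂ) ≠ 0 := by exact_mod_cast hf0.ne'
  have hI : (Fintype.card (c.inertia q) : ℂ) ≠ 0 := by exact_mod_cast Fintype.card_ne_zero
  let E := (T.eigenspace ζ).map (c.inertiaInvariants q ρ).subtype
  have hE : finrank ℂ E = finrank ℂ (T.eigenspace ζ) :=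
    (Submodule.equivMapOfInjective _ (Submodule.injective_subtype _) _).finrank_eq.symm
  rw [← hE]
  refine LinearMap.IsProj.trace ⟨fun v => ?_, ?_⟩
  · let w : V := ((Nat.card (c.inertia q) : ℂ)⁻¹ • ∑ h : c.inertia q, ρ h) v
    -- Averaging over `I` lands in the `I`-invariants; on these `u = ζ⁻¹ T` satisfies `uᶠ = 1`.
    have hw : w ∈ c.inertiaInvariants q ρ := by
      intro g
      change ρ g w = w
      simp only [w, LinearMap.smul_apply, map_smul, LinearMap.sum_apply, map_sum]
      congr 1
      simp_rw [← Module.End.mul_apply, ← map_mul]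
      exact Fintype.sum_equiv (Equiv.mulLeft g) _ _ fun h => rfl
    let u : End ℂ (c.inertiaInvariants q ρ) := ζ⁻¹ • T
    have hu : u ^ f = 1 := by
      rw [_root_.smul_pow, c.frobAction_pow_eq_one q ρ hf, inv_pow, hζ, inv_one, one_smul]
    refine ⟨((f : ℂ)⁻¹ • ∑ k ∈ Finset.range f, u ^ k) ⟨w, hw⟩, ?_, ?_⟩
    · have h1 : u * ∑ k ∈ Finset.range f, u ^ k = ∑ k ∈ Finset.range f, u ^ k := by
        rw [← sub_eq_zero, ← sub_one_mul, mul_geom_sum, hu, sub_self]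
      have h2 : T * ((f : ℂ)⁻¹ • ∑ k ∈ Finset.range f, u ^ k) =
          ζ • ((f : ℂ)⁻¹ • ∑ k ∈ Finset.range f, u ^ k) := by
        rw [show T = ζ • u from (smul_inv_smul₀ hζ0 T).symm, smul_mul_assoc, mul_smul_comm, h1]
      exact End.mem_eigenspace_iff.mpr (LinearMap.congr_fun h2 ⟨w, hw⟩)
    -- The polynomial in `u` computes `e_ζ v`, so `e_ζ v` lies in the eigenspace.
    · rw [asAlgebraHom_eigenProjector, Module.End.mul_apply]
      have h1 : ∀ k, (((u ^ k) ⟨w, hw⟩ : c.inertiaInvariants q ρ) : V) =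
          ((ζ⁻¹ • ρ (c.frob q)) ^ k) w := by
        intro k
        simp [u, T, _root_.smul_pow, coe_frobAction_pow]
      change _ = ((f : ℂ)⁻¹ • ∑ k ∈ Finset.range f, (ζ⁻¹ • ρ (c.frob q)) ^ k) w
      simp only [Submodule.subtype_apply, LinearMap.smul_apply, LinearMap.sum_apply,
        Submodule.coe_smul, Submodule.coe_sum, h1]
  · rintro _ ⟨v, hv, rfl⟩
    rw [SetLike.mem_coe, End.mem_eigenspace_iff] at hv
    have h1 : ∀ h : c.inertia q, ρ h (v : V) = v := fun h => v.2 h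
    have h2 : ρ (c.frob q) (v : V) = ζ • (v : V) := congrArg Subtype.val hv
    have h3 : ∀ k, ((ζ⁻¹ • ρ (c.frob q)) ^ k) (v : V) = v := by
      intro k
      induction k with
      | zero => simp
      | succ k ih =>
        rw [pow_succ, Module.End.mul_apply, LinearMap.smul_apply, h2, inv_smul_smul₀ hζ0, ih]
    rw [asAlgebraHom_eigenProjector, Module.End.mul_apply]
    simp only [Submodule.subtype_apply, LinearMap.smul_apply, LinearMap.sum_apply, h1,
      Finset.sum_const, Finset.card_univ, Nat.card_eq_fintype_card]
    rw [← Nat.cast_smul_eq_nsmul ℂ, inv_smul_smul₀ hI]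
    simp only [h3, Finset.sum_const, Finset.card_range]
    rw [← Nat.cast_smul_eq_nsmul ℂ, inv_smul_smul₀ hf']

end Eigenspace

theorem inertiaDeg_eq {p : Ideal (𝓞 L)}
    (hp : p ∈ IsDedekindDomain.primesOverFinset q.asIdeal (𝓞 L)) :
    p.inertiaDeg (𝓞 K) = (c.primeOver q).inertiaDeg (𝓞 K) := by
  have := q.isMaximal
  obtain ⟨h1, h2⟩ := (IsDedekindDomain.mem_primesOverFinset_iff q.ne_bot (𝓞 L)).mp hp
  have := c.isPrime q
  have := c.liesOver q
  exact Ideal.inertiaDeg_eq_of_isGaloisGroup q.asIdeal _ _ Gal(L/K)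

theorem inertiaDeg_pos : 0 < (c.primeOver q).inertiaDeg (𝓞 K) := by
  have := q.isMaximal
  have := c.isPrime q
  have := c.liesOver q
  exact Ideal.inertiaDeg_pos _ _

theorem card_mul_card_inertia_mul_inertiaDeg :
    (IsDedekindDomain.primesOverFinset q.asIdeal (𝓞 L)).card * Nat.card (c.inertia q) *
      (c.primeOver q).inertiaDeg (𝓞 K) = Nat.card Gal(L/K) := by
  have := q.isMaximal
  have := c.isPrime q
  have := c.liesOver q
  have : Finite (𝓞 K ⧸ q.asIdeal) := Ring.HasFiniteQuotients.finiteQuotient q.ne_bot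
  have h := Ideal.ncard_primesOver_mul_card_inertia_mul_finrank (G := Gal(L/K)) q.asIdeal
    (c.primeOver q)
  rwa [← IsDedekindDomain.coe_primesOverFinset q.ne_bot, Set.ncard_coe_finset] at h

/-- Modulo inertia the Frobenius has order `f`, since it induces the Frobenius of the extension of
residue fields, which generates a Galois group of order `f`. -/
theorem frob_pow_mem_inertia_iff (k : ℕ) :
    c.frob q ^ k ∈ c.inertia q ↔ (c.primeOver q).inertiaDeg (𝓞 K) ∣ k := by
  have := q.isMaximal
  have := c.isPrime q
  have := c.liesOver q
  have : Finite (𝓞 K ⧸ q.asIdeal) := Ring.HasFiniteQuotients.finiteQuotient q.ne_bot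
  have hQ0 : c.primeOver q ≠ ⊥ := Ideal.ne_bot_of_liesOver_of_ne_bot q.ne_bot _
  have : Finite (𝓞 L ⧸ c.primeOver q) := Ring.HasFiniteQuotients.finiteQuotient hQ0
  have : (c.primeOver q).IsMaximal := (c.isPrime q).isMaximal hQ0
  let : Field (𝓞 K ⧸ q.asIdeal) := Ideal.Quotient.field _
  let : Field (𝓞 L ⧸ c.primeOver q) := Ideal.Quotient.field _
  let : Fintype (𝓞 K ⧸ q.asIdeal) := Fintype.ofFinite _
  let F := FiniteField.frobeniusAlgHom (𝓞 K ⧸ q.asIdeal) (𝓞 L ⧸ c.primeOver q)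
  have hF : ∀ x : 𝓞 L, Ideal.Quotient.mk (c.primeOver q) (c.frob q • x) =
      F (Ideal.Quotient.mk (c.primeOver q) x) := by
    intro x
    have h := (c.isArithFrobAt q).mk_apply x
    rw [← Ideal.over_def (c.primeOver q) q.asIdeal, Nat.card_eq_fintype_card] at h
    exact h
  have hFk : ∀ (k : ℕ) (x : 𝓞 L), Ideal.Quotient.mk (c.primeOver q) (c.frob q ^ k • x) =
      (F ^ k) (Ideal.Quotient.mk (c.primeOver q) x) := by
    intro k
    induction k with
    | zero => intro x; simp
    | succ k ih => intro x; rw [pow_succ', pow_succ', mul_smul, hF, ih]; rfl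
  have hdeg : (c.primeOver q).inertiaDeg (𝓞 K) = orderOf F := by
    rw [FiniteField.orderOf_frobeniusAlgHom]
    exact Ideal.inertiaDeg_eq_of_isMaximal _ _
  rw [hdeg, orderOf_dvd_iff_pow_eq_one]
  constructor
  · intro h
    ext y
    obtain ⟨x, rfl⟩ := Ideal.Quotient.mk_surjective y
    rw [← hFk, AlgHom.one_apply, Ideal.Quotient.mk_eq_mk_iff_sub_mem]
    exact h x
  · intro h x
    have := hFk k x
    rwa [h, AlgHom.one_apply, Ideal.Quotient.mk_eq_mk_iff_sub_mem] at this

/-! ### The Euler factor at a prime -/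

theorem frobDet_eq_reverse_charpoly {V : Type*} [AddCommGroup V] [Module ℂ V]
    [FiniteDimensional ℂ V] (ρ : Representation ℂ Gal(L/K) V) :
    c.frobDet q ρ = (c.frobAction q ρ).charpoly.reverse := by
  rw [frobDet, ← Matrix.reverse_charpoly, LinearMap.charpoly_toMatrix]

variable {ι : Type*} [Fintype ι] {V : ι → Type*} [∀ i, AddCommGroup (V i)] [∀ i, Module ℂ (V i)]
    [∀ i, FiniteDimensional ℂ (V i)] {ρ : ∀ i, Representation ℂ Gal(L/K) (V i)}

/-- The multiplicities with which a given `f`-th root of unity `ζ` is an eigenvalue of Frobenius on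
the inertia invariants of the irreducible representations, weighted by their dimensions, add up to
the number of primes above `q`, independently of `ζ`. The trivial representation contributes only
to `ζ = 1`. Both sides are the trace of the projector
`e_ζ` on the regular representation, since `|G| = g |I| f`. -/
theorem sum_finrank_eigenspace [DecidableEq ℂ] (hρ : RepresentsNontrivialIrreps ρ) {ζ : ℂ}
    (hζ : ζ ^ (c.primeOver q).inertiaDeg (𝓞 K) = 1) :
    (if ζ = 1 then 1 else 0) +
      ∑ i, finrank ℂ (V i) * finrank ℂ (End.eigenspace (c.frobAction q (ρ i)) ζ) =
    (IsDedekindDomain.primesOverFinset q.asIdeal (𝓞 L)).card := by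
  have hf := c.inertiaDeg_pos q
  have hI : 0 < Nat.card (c.inertia q) := Nat.card_pos
  have h := hρ.trace_regular.2
    (eigenProjector (c.frob q) (c.inertia q) ((c.primeOver q).inertiaDeg (𝓞 K)) ζ)
  rw [trace_trivial_eigenProjector _ _ hf hζ,
    coeff_one_eigenProjector hf (c.frob_pow_mem_inertia_iff q),
    ← c.card_mul_card_inertia_mul_inertiaDeg q] at h
  simp_rw [c.trace_eigenProjector q _ hf ((c.frob_pow_mem_inertia_iff q _).mpr dvd_rfl) hζ] at h
  have hf' : ((c.primeOver q).inertiaDeg (𝓞 K) : ℂ) ≠ 0 := by exact_mod_cast hf.ne'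
  have hI' : (Nat.card (c.inertia q) : ℂ) ≠ 0 := by exact_mod_cast hI.ne'
  have h2 : (((IsDedekindDomain.primesOverFinset q.asIdeal (𝓞 L)).card * Nat.card (c.inertia q) *
      (c.primeOver q).inertiaDeg (𝓞 K) : ℕ) : ℂ) *
      (((c.primeOver q).inertiaDeg (𝓞 K) : ℂ)⁻¹ * (Nat.card (c.inertia q) : ℂ)⁻¹) =
      (IsDedekindDomain.primesOverFinset q.asIdeal (𝓞 L)).card := by
    push_cast
    field_simp
  rw [h2] at h
  exact_mod_cast h

/-- The identity of Euler factors at `q`. -/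
theorem prod_one_sub_X_pow_inertiaDeg (hρ : RepresentsNontrivialIrreps ρ) :
    ∏ p ∈ IsDedekindDomain.primesOverFinset q.asIdeal (𝓞 L),
        (1 - X ^ p.inertiaDeg (𝓞 K) : QAb[X]) =
      (1 - X) * ∏ i, c.frobPoly q (ρ i) ^ finrank ℂ (V i) := by
  classical
  apply Polynomial.map_injective _ (algebraMap QAb ℂ).injective
  set f := (c.primeOver q).inertiaDeg (𝓞 K) with hfdef
  have hf : 0 < f := c.inertiaDeg_pos q
  have hfC : (f : ℂ) ≠ 0 := by exact_mod_cast hf.ne'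
  rw [Finset.prod_congr rfl fun p hp => by rw [c.inertiaDeg_eq q hp], Finset.prod_const]
  simp only [Polynomial.map_pow, Polynomial.map_sub, Polynomial.map_one, map_X, Polynomial.map_mul,
    Polynomial.map_prod, map_frobPoly, frobDet_eq_reverse_charpoly]
  have h1 : (1 - X : ℂ[X]) = (X - 1 : ℂ[X]).reverse := by
    simpa using (reverse_X_pow_sub_one (R := ℂ) 1).symm
  -- Both sides are reverses of monic polynomials that split over the `f`-th roots of unity.
  rw [← hfdef, ← reverse_X_pow_sub_one, h1]
  simp only [← reverse_pow_of_domain, ← reverse_prod_of_domain, ← reverse_mul_of_domain]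
  congr 1
  have hfrob : c.frob q ^ f ∈ c.inertia q := (c.frob_pow_mem_inertia_iff q f).mpr dvd_rfl
  have hX : (X - 1 : ℂ[X]) =
      ∏ ζ ∈ nthRootsFinset f (1 : ℂ), (X - C ζ) ^ (if ζ = 1 then 1 else 0) := by
    rw [Finset.prod_eq_single 1]
    · simp
    · intro ζ _ h
      simp [h]
    · intro h
      simp [mem_nthRootsFinset hf] at h
  have hc : ∀ i, (c.frobAction q (ρ i)).charpoly ^ finrank ℂ (V i) =
      ∏ ζ ∈ nthRootsFinset f (1 : ℂ), (X - C ζ) ^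
        (finrank ℂ (V i) * finrank ℂ (End.eigenspace (c.frobAction q (ρ i)) ζ)) := by
    intro i
    rw [charpoly_eq_prod_of_pow_eq_one _ hfC (c.frobAction_pow_eq_one q (ρ i) hfrob),
      ← Finset.prod_pow]
    exact Finset.prod_congr rfl fun ζ _ => by rw [← pow_mul, mul_comm]
  rw [X_pow_sub_one_eq_prod hf (Complex.isPrimitiveRoot_exp f hf.ne'), hX]
  simp_rw [hc]
  rw [Finset.prod_comm, ← Finset.prod_mul_distrib, ← Finset.prod_pow]
  refine Finset.prod_congr rfl fun ζ hζ => ?_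
  rw [Finset.prod_pow_eq_pow_sum, ← pow_add,
    c.sum_finrank_eigenspace q hρ ((mem_nthRootsFinset hf _).mp hζ)]

end FrobeniusChoice

end

end ArithSymm

theorem mainTheorem6 {K L : Type*} [Field K] [NumberField K] [Field L] [NumberField L]
    [Algebra K L] [IsGalois K L] (c : ArithSymm.FrobeniusChoice K L)
    {ι : Type*} {V : ι → Type*} [∀ i, AddCommGroup (V i)] [∀ i, Module ℂ (V i)]
    [∀ i, FiniteDimensional ℂ (V i)] (ρ : ∀ i, Representation ℂ Gal(L/K) (V i))
    (hρ : ArithSymm.RepresentsNontrivialIrreps ρ) :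
    Finite ι ∧
      ArithSymm.relDedekind K L =
        ArithSymm.dedekind K * ∏ᶠ i, ArithSymm.artin c (ρ i) ^ Module.finrank ℂ (V i) := by
  have hι : Finite ι := hρ.trace_regular.1
  refine ⟨hι, ?_⟩
  have : Fintype ι := Fintype.ofFinite ι
  rw [finprod_eq_prod_of_fintype]
  apply Subtype.ext
  simp only [MulMemClass.coe_mul, SubmonoidClass.coe_finsetProd, SubmonoidClass.coe_pow]
  -- The three functions unfold to the formal products that define them.
  change ArithSymm.formalProd _ = ArithSymm.formalProd _ * ∏ i, ArithSymm.formalProd _ ^ _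
  have hpow := fun i => ArithSymm.formalProd_pow (ArithSymm.formallyMultipliable_artin c (ρ i))
    (Module.finrank ℂ (V i))
  have hprod := ArithSymm.formalProd_prod Finset.univ fun i _ => (hpow i).1
  simp_rw [← fun i => (hpow i).2]
  rw [← hprod.2, ← ArithSymm.formalProd_mul (ArithSymm.formallyMultipliable_dedekind K) hprod.1]
  congr 1
  funext q
  have h1 : (1 - Polynomial.X : Polynomial ArithSymm.QAb).coeff 0 = 1 := by simp
  have h2 : ∀ i, (c.frobPoly q (ρ i) ^ Module.finrank ℂ (V i)).coeff 0 = 1 := fun i => by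
    rw [Polynomial.coeff_zero_eq_eval_zero, Polynomial.eval_pow,
      ← Polynomial.coeff_zero_eq_eval_zero, c.coeff_zero_frobPoly, one_pow]
  rw [← ArithSymm.alphabetProd_prod q _ fun p hp => by
      simp [Polynomial.coeff_X_pow, (ArithSymm.inertiaDeg_ne_zero_of_mem q hp).symm],
    c.prod_one_sub_X_pow_inertiaDeg q hρ, ArithSymm.alphabetProd_mul q h1,
    ArithSymm.alphabetProd_prod q _ fun i _ => h2 i]
  · congr 1
    exact Finset.prod_congr rfl fun i _ =>
      ArithSymm.alphabetProd_pow q (c.coeff_zero_frobPoly q (ρ i)) _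
  · rw [Polynomial.coeff_zero_prod]
    exact Finset.prod_eq_one fun i _ => h2 i
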